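/- Let $p, d$ be integers with $p \ge 2$ and $d \ge 4p^2 - 2p + 1$, and let $r_1, \dots, r_p$ be positive real numbers. Let $S_{r}^{d-1} = \{x \in \mathbb{R}^d : \|x\| = r\}$ denote the sphere of radius $r$ centred at the origin. Let $Y \subset \mathbb{R}^d$ be an antipodal set (that is, $-y \in Y$ for every $y \in Y$) contained in $S_{r_1}^{d-1} \cup \dots \cup S_{r_p}^{d-1}$, with $$|Y| = 2 \sum_{i=0}^{p-1} \binom{d+2p-1-2i}{2p-2i}.$$ For $1 \le i \le p$ let $Y_i = Y \cap S_{r_i}^{d-1}$ be the $i$th layer of $Y$, and let $$A(Y_i) = \{\langle x, y\rangle / r_i^2 : x, y \in Y_i,\ x \ne y\}.$$ Assume that $|A(Y_i)| \le 2p+1$ for every $i$. Then there exists an index $l$ such that $Y_l$ is non-empty and every $\alpha \in A(Y_l)$ is a rational number. -/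

import Mathlib

/-- The layer of `Y` of radius `r`: the points of `Y` on the sphere of radius `r` centred at the
origin of `ℝᵈ`. -/
def layer {d : ℕ} (Y : Set (EuclideanSpace ℝ (Fin d))) (r : ℝ) :
    Set (EuclideanSpace ℝ (Fin d)) :=
  Y ∩ Metric.sphere 0 r

/-- The set `A(Z)` of normalized inner products `⟨x, y⟩ / r²` between distinct points `x, y` of a
set `Z` lying on the sphere of radius `r` centred at the origin. -/
def normalizedInnerProducts {d : ℕ} (Z : Set (EuclideanSpace ℝ (Fin d))) (r : ℝ) : Set ℝ :=
  {α | ∃ x ∈ Z, ∃ y ∈ Z, x ≠ y ∧ α = inner ℝ x y / r ^ 2}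

/-- `Y` is antipodal: it contains `-y` whenever it contains `y`. -/
def IsAntipodal {d : ℕ} (Y : Set (EuclideanSpace ℝ (Fin d))) : Prop :=
  ∀ y ∈ Y, -y ∈ Y

/-! Let `N = Nat.choose (d + 2p - 2) (2p - 1)`, the dimension of the forms of degree `2p - 1`. By
pigeonhole some layer has more than `4N` points. One point from each antipodal pair gives a set `X`
of more than `2N` points, where the normalized inner product `t` takes at most `p` absolute values.
Given such a value `b ≠ 0`, let `G`, of degree at most `p - 1`, vanish at the squares of the others.
For `e = 0, 1` the matrix `t ^ e * G(t²) / (b ^ e * G(b²))` on `X` has off-diagonal entries `0, ±1`,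
constant diagonal `θ_e = G(1) / (b ^ e * G(b²))` and rank below `|X| / 2`. So `-θ_e` is an
eigenvalue of a rational matrix with multiplicity above half its size; were it irrational, a
conjugate would have the same multiplicity. Hence `θ_e` is rational, and so is `b = θ_0 / θ_1`. -/

/-! ### Rationality from high eigenvalue multiplicity -/

open Polynomial in
/-- An irrational number has multiplicity at most half the degree as a root of a rational
polynomial. -/
theorem two_mul_rootMultiplicity_le_natDegree {θ : ℝ} (hθ : Irrational θ) (f : ℚ[X])
    (hf : f ≠ 0) :
    2 * (f.map (algebraMap ℚ ℝ)).rootMultiplicity θ ≤ f.natDegree := by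
  induction hn : f.natDegree using Nat.strong_induction_on generalizing f with
  | _ n ih =>
  by_cases hroot : (f.map (algebraMap ℚ ℝ)).IsRoot θ
  · have haev : aeval θ f = 0 := by
      rwa [IsRoot.def, eval_map_algebraMap] at hroot
    have hint : IsIntegral ℚ θ := isAlgebraic_iff_isIntegral.mp ⟨f, hf, haev⟩
    obtain ⟨h, rfl⟩ := minpoly.dvd ℚ θ haev
    have hh : h ≠ 0 := right_ne_zero_of_mul hf
    have hm : minpoly ℚ θ ≠ 0 := left_ne_zero_of_mul hf
    have hdeg : 2 ≤ (minpoly ℚ θ).natDegree := by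
      rw [minpoly.two_le_natDegree_iff hint]
      rintro ⟨q, hq⟩
      exact hθ ⟨q, by simpa using hq⟩
    have hsep : ((minpoly ℚ θ).map (algebraMap ℚ ℝ)).rootMultiplicity θ ≤ 1 :=
      rootMultiplicity_le_one_of_separable (minpoly.irreducible hint).separable.map θ
    rw [natDegree_mul hm hh] at hn
    have := ih h.natDegree (by omega) h hh rfl
    rw [Polynomial.map_mul, rootMultiplicity_mul]
    · omega
    · rw [← Polynomial.map_mul]
      exact (Polynomial.map_ne_zero_iff (algebraMap ℚ ℝ).injective).mpr hf
  · rw [rootMultiplicity_eq_zero hroot]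
    omega

/-- If a matrix with constant diagonal `θ` and rational off-diagonal entries has rank less than half
its size, then `θ` is rational. -/
theorem Matrix.not_irrational_of_two_mul_rank_lt {ι : Type*} [Fintype ι] [DecidableEq ι]
    {M : Matrix ι ι ℝ} {θ : ℝ} (hdiag : ∀ i, M i i = θ)
    (hoff : ∀ i j, i ≠ j → ∃ q : ℚ, M i j = q) (hrank : 2 * M.rank < Fintype.card ι) :
    ¬ Irrational θ := by
  intro hθ
  choose! q hq using hoff
  let S : Matrix ι ι ℚ := Matrix.of fun i j => if i = j then 0 else q i j
  have hM : M = S.map (algebraMap ℚ ℝ) - Matrix.scalar ι (-θ) := by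
    ext i j
    by_cases hij : i = j
    · subst hij
      simp [S, hdiag]
    · simp [S, hij, hq i j hij]
  have hneg : Irrational (-θ) := hθ.neg
  have hle := two_mul_rootMultiplicity_le_natDegree hneg S.charpoly S.charpoly_monic.ne_zero
  rw [Matrix.charpoly_natDegree_eq_dim, ← Matrix.charpoly_map] at hle
  -- The kernel of `M`, of dimension over half the size, is the `-θ`-eigenspace of `S`; geometric
  -- multiplicity is at most algebraic.
  have heig := LinearMap.finrank_eigenspace_le (S.map (algebraMap ℚ ℝ)).toLin' (-θ)
  rw [Matrix.charpoly_toLin'] at heig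
  have hker : Module.End.eigenspace (S.map (algebraMap ℚ ℝ)).toLin' (-θ) =
      LinearMap.ker M.toLin' := by
    rw [Module.End.eigenspace_def, hM, map_sub]
    congr 2
    ext
    simp [Matrix.toLin'_apply, Pi.single_apply]
    split_ifs <;> simp
  rw [hker] at heig
  have hrn := LinearMap.finrank_range_add_finrank_ker M.toLin'
  rw [Module.finrank_fintype_fun_eq_card] at hrn
  have hr : M.rank = Module.finrank ℝ (LinearMap.range M.toLin') := by
    rw [Matrix.toLin'_apply', Matrix.rank]
  omega

/-! ### Rank bounds for kernels on a sphere -/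

open MvPolynomial in
/-- A matrix whose columns are the values of forms of degree `m` in `d` variables has rank at most
the dimension of the space of such forms. -/
theorem Matrix.rank_le_of_forall_isHomogeneous {ι : Type*} [Fintype ι] {d m : ℕ}
    {M : Matrix ι ι ℝ} (v : ι → Fin d → ℝ) (P : ι → MvPolynomial (Fin d) ℝ)
    (hP : ∀ j, (P j).IsHomogeneous m) (hM : ∀ i j, M i j = eval (v i) (P j)) :
    M.rank ≤ Nat.choose (d + m - 1) m := by
  let T := Finset.finsuppAntidiag (Finset.univ : Finset (Fin d)) m
  let E : Matrix ι T ℝ := Matrix.of fun i s => ∏ k, v i k ^ s.1 k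
  let C : Matrix T ι ℝ := Matrix.of fun s j => (P j).coeff s.1
  have hEC : M = E * C := by
    ext i j
    rw [hM, Matrix.mul_apply, eval_eq']
    simp only [E, C, Matrix.of_apply]
    rw [Finset.sum_coe_sort T fun s => (∏ k, v i k ^ s k) * (P j).coeff s]
    refine (Finset.sum_subset ?_ ?_).trans (Finset.sum_congr rfl fun s _ => mul_comm _ _)
    · intro s hs
      have : s.degree = m := by
        rw [Finsupp.degree_eq_weight_one (R := ℕ)]
        exact hP j (mem_support_iff.mp hs)
      rw [Finsupp.degree_eq_sum] at this
      simp [T, Finset.mem_finsuppAntidiag, this]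
    · intro s _ hs
      rw [notMem_support_iff.mp hs, zero_mul]
  calc M.rank ≤ E.rank := hEC ▸ Matrix.rank_mul_le_left E C
    _ ≤ Fintype.card T := Matrix.rank_le_card_width E
    _ = Nat.choose (d + m - 1) m := by
      rw [Fintype.card_coe, Finset.card_finsuppAntidiag_nat_eq_choose]
      simp

open MvPolynomial in
/-- On a sphere of radius `r`, the kernel `t ^ e * F (t ^ 2)` with `t = ⟨x, y⟩ / r ^ 2` has rank at
most the dimension of the space of forms of degree `2 * k + e`, when `F` has degree at most `k`. -/
theorem rank_inner_kernel_le {ι : Type*} [Fintype ι] {d k e : ℕ} {r : ℝ} (hr : 0 < r)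
    (v : ι → EuclideanSpace ℝ (Fin d)) (hv : ∀ i, ‖v i‖ = r) (F : Polynomial ℝ)
    (hF : F.natDegree ≤ k) :
    (Matrix.of fun i j => (inner ℝ (v i) (v j) / r ^ 2) ^ e *
      F.eval ((inner ℝ (v i) (v j) / r ^ 2) ^ 2)).rank ≤
      Nat.choose (d + (2 * k + e) - 1) (2 * k + e) := by
  let L : ι → MvPolynomial (Fin d) ℝ := fun j => ∑ a, C (v j a / r ^ 2) * X a
  -- `Q` is `1` on the sphere, so its powers homogenize the kernel without changing its values.
  let Q : MvPolynomial (Fin d) ℝ := ∑ a, C (1 / r ^ 2) * X a ^ 2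
  have hL : ∀ j, (L j).IsHomogeneous 1 := fun j =>
    IsHomogeneous.sum _ _ _ fun a _ => isHomogeneous_C_mul_X _ a
  have hQ : Q.IsHomogeneous 2 :=
    IsHomogeneous.sum _ _ _ fun a _ => (isHomogeneous_X_pow a 2).C_mul _
  have hLv : ∀ i j, eval (v i) (L j) = inner ℝ (v i) (v j) / r ^ 2 := fun i j => by
    simp only [L, map_sum, map_mul, eval_C, eval_X, PiLp.inner_apply, Finset.sum_div]
    refine Finset.sum_congr rfl fun a _ => ?_
    simp
    ring
  have hQv : ∀ i, eval (v i) Q = 1 := fun i => by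
    simp only [Q, map_sum, map_mul, map_pow, eval_C, eval_X, ← Finset.mul_sum]
    rw [← EuclideanSpace.real_norm_sq_eq, hv]
    field_simp
  refine Matrix.rank_le_of_forall_isHomogeneous (fun i => v i)
    (fun j => L j ^ e * ∑ n ∈ Finset.range (k + 1), C (F.coeff n) * (L j ^ (2 * n) * Q ^ (k - n)))
    (fun j => ?_) (fun i j => ?_)
  · rw [add_comm (2 * k) e]
    refine IsHomogeneous.mul (by simpa using (hL j).pow e) (IsHomogeneous.sum _ _ _ fun n hn => ?_)
    have hn' : n ≤ k := Nat.lt_succ_iff.mp (Finset.mem_range.mp hn)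
    have := (isHomogeneous_C (Fin d) (F.coeff n)).mul
      (((hL j).pow (2 * n)).mul (hQ.pow (k - n)))
    convert this using 1
    omega
  · simp only [Matrix.of_apply, map_mul, map_pow, map_sum, hLv, hQv, eval_C, one_pow, mul_one]
    rw [Polynomial.eval_eq_sum_range' (Nat.lt_succ_iff.mpr hF)]
    simp only [pow_mul]

/-! ### Rationality within one layer -/

open Polynomial in
/-- If the absolute values of the normalized inner products between the points of a large subset of
a sphere lie in a set `B` of at most `k + 1` numbers, none of which is `1`, then every element of `B`
is rational. -/
theorem not_irrational_of_abs_inner_mem {d k : ℕ} {r : ℝ} (hr : 0 < r)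
    (X : Finset (EuclideanSpace ℝ (Fin d))) (hX : ∀ x ∈ X, ‖x‖ = r) (B : Finset ℝ)
    (hBcard : B.card ≤ k + 1) (hB0 : ∀ b ∈ B, 0 ≤ b) (hB1 : (1 : ℝ) ∉ B)
    (hXB : ∀ x ∈ X, ∀ y ∈ X, x ≠ y → |inner ℝ x y / r ^ 2| ∈ B)
    (hcard : 2 * Nat.choose (d + (2 * k + 1) - 1) (2 * k + 1) < X.card)
    (hcard' : 2 * Nat.choose (d + 2 * k - 1) (2 * k) < X.card) (b : ℝ) (hb : b ∈ B) :
    ¬ Irrational b := by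
  classical
  rcases eq_or_ne b 0 with rfl | hb0
  · exact not_irrational_zero
  let G : ℝ[X] := ∏ c ∈ B.erase b, (Polynomial.X - C (c ^ 2))
  have hG : ∀ u, G.eval u = ∏ c ∈ B.erase b, (u - c ^ 2) := fun u => by
    simp [G, eval_prod]
  have hne : ∀ c ∈ B, ∀ a, 0 ≤ a → a ≠ c → a ^ 2 - c ^ 2 ≠ 0 := fun c hc a ha hac h =>
    hac ((sq_eq_sq₀ ha (hB0 c hc)).mp (sub_eq_zero.mp h))
  have hGb : G.eval (b ^ 2) ≠ 0 := by
    rw [hG]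
    exact Finset.prod_ne_zero_iff.mpr fun c hc =>
      hne c (Finset.mem_of_mem_erase hc) b (hB0 b hb) (Finset.ne_of_mem_erase hc).symm
  have hG1 : G.eval 1 ≠ 0 := by
    rw [hG]
    refine Finset.prod_ne_zero_iff.mpr fun c hc => ?_
    have hcB := Finset.mem_of_mem_erase hc
    simpa using hne c hcB 1 zero_le_one fun h => hB1 (h ▸ hcB)
  have hGc : ∀ c ∈ B, c ≠ b → G.eval (c ^ 2) = 0 := fun c hc hcb => by
    rw [hG]
    exact Finset.prod_eq_zero (Finset.mem_erase.mpr ⟨hcb, hc⟩) (sub_self _)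
  have hGdeg : G.natDegree ≤ k := by
    refine (natDegree_prod_le _ _).trans ?_
    calc ∑ c ∈ B.erase b, (Polynomial.X - C (c ^ 2) : ℝ[X]).natDegree = (B.erase b).card := by
          simp only [natDegree_X_sub_C, Finset.sum_const, smul_eq_mul, mul_one]
      _ ≤ k := by
          rw [Finset.card_erase_of_mem hb]
          omega
  have key : ∀ e : ℕ, 2 * Nat.choose (d + (2 * k + e) - 1) (2 * k + e) < X.card →
      ¬ Irrational (G.eval 1 / (b ^ e * G.eval (b ^ 2))) := by
    intro e he
    have hrank := rank_inner_kernel_le (e := e) hr (fun x : X => x.1) (fun x => hX x.1 x.2)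
      (C (b ^ e * G.eval (b ^ 2))⁻¹ * G) ((natDegree_C_mul_le _ _).trans hGdeg)
    refine Matrix.not_irrational_of_two_mul_rank_lt (fun x => ?_) (fun x y hxy => ?_)
      (lt_of_le_of_lt (Nat.mul_le_mul_left 2 hrank) (by simpa using he))
    · have : inner ℝ x.1 x.1 / r ^ 2 = 1 := by
        rw [real_inner_self_eq_norm_sq, hX x.1 x.2, div_self (by positivity)]
      simp only [Matrix.of_apply, this, one_pow, one_mul, eval_mul, eval_C]
      rw [div_eq_inv_mul]
    · have hmem := hXB x.1 x.2 y.1 y.2 (Subtype.coe_injective.ne hxy)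
      simp only [Matrix.of_apply, eval_mul, eval_C]
      generalize inner ℝ x.1 y.1 / r ^ 2 = t at hmem ⊢
      rw [← sq_abs t]
      by_cases htb : |t| = b
      · rw [htb]
        rcases abs_choice t with h | h
        · refine ⟨1, ?_⟩
          rw [← h, htb]
          field_simp
          simp
        · refine ⟨(-1) ^ e, ?_⟩
          rw [← neg_eq_iff_eq_neg.mpr h, htb, neg_pow]
          push_cast
          field_simp
      · exact ⟨0, by rw [hGc _ hmem htb]; simp⟩
  have h0 := key 0 hcard'
  have h1 := key 1 hcard
  simp only [Irrational, not_not, Set.mem_range] at h0 h1 ⊢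
  obtain ⟨q₀, hq₀⟩ := h0
  obtain ⟨q₁, hq₁⟩ := h1
  refine ⟨q₀ / q₁, ?_⟩
  push_cast
  rw [hq₀, hq₁]
  field_simp

/-- A finite antipodal set without the origin contains one point of each antipodal pair. -/
theorem IsAntipodal.exists_half {d : ℕ} {Z : Finset (EuclideanSpace ℝ (Fin d))}
    (hZ : IsAntipodal (Z : Set (EuclideanSpace ℝ (Fin d)))) (h0 : 0 ∉ Z) :
    ∃ X ⊆ Z, Z.card ≤ 2 * X.card ∧ ∀ x ∈ X, -x ∉ X := by
  classical
  have : IsAddTorsionFree (EuclideanSpace ℝ (Fin d)) := .of_isTorsionFree ℝ _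
  let R : EuclideanSpace ℝ (Fin d) → EuclideanSpace ℝ (Fin d) → Prop := WellOrderingRel
  refine ⟨Z.filter fun x => R x (-x), Finset.filter_subset _ _, ?_, fun x hx hx' => ?_⟩
  · have hcover : Z ⊆ Z.filter (fun x => R x (-x)) ∪
        (Z.filter fun x => R x (-x)).image Neg.neg := by
      intro x hx
      rcases trichotomous_of R x (-x) with h | h | h
      · exact Finset.mem_union_left _ (Finset.mem_filter.mpr ⟨hx, h⟩)
      · exact absurd (self_eq_neg.mp h ▸ hx) h0
      · exact Finset.mem_union_right _ (Finset.mem_image.mpr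
          ⟨-x, Finset.mem_filter.mpr ⟨hZ x hx, by rwa [neg_neg]⟩, neg_neg x⟩)
    have h1 := (Finset.card_le_card hcover).trans (Finset.card_union_le _ _)
    have h2 := Finset.card_image_le (s := Z.filter fun x => R x (-x)) (f := Neg.neg)
    omega
  · have h1 := (Finset.mem_filter.mp hx).2
    have h2 := (Finset.mem_filter.mp hx').2
    rw [neg_neg] at h2
    exact asymm_of R h1 h2

/-- A finite set of reals closed under negation has about half of its elements nonnegative. -/
theorem two_mul_card_filter_nonneg_le (A : Finset ℝ) (hA : ∀ a ∈ A, -a ∈ A) :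
    2 * (A.filter (0 ≤ ·)).card ≤ A.card + 1 := by
  classical
  have himg : ((A.filter (0 ≤ ·)).image Neg.neg).card = (A.filter (0 ≤ ·)).card :=
    Finset.card_image_of_injective _ neg_injective
  have hunion : A.filter (0 ≤ ·) ∪ (A.filter (0 ≤ ·)).image Neg.neg ⊆ A :=
    Finset.union_subset (Finset.filter_subset _ _) <| by
      intro b hb
      obtain ⟨a, ha, rfl⟩ := Finset.mem_image.mp hb
      exact hA a (Finset.mem_filter.mp ha).1
  have hinter : A.filter (0 ≤ ·) ∩ (A.filter (0 ≤ ·)).image Neg.neg ⊆ {0} := by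
    intro a ha
    obtain ⟨ha, ha'⟩ := Finset.mem_inter.mp ha
    obtain ⟨c, hc, rfl⟩ := Finset.mem_image.mp ha'
    have h1 := (Finset.mem_filter.mp ha).2
    have h2 := (Finset.mem_filter.mp hc).2
    rw [Finset.mem_singleton]
    linarith
  have h1 := Finset.card_union_add_card_inter (A.filter (0 ≤ ·))
    ((A.filter (0 ≤ ·)).image Neg.neg)
  have h2 := Finset.card_le_card hunion
  have h3 := Finset.card_le_card hinter
  rw [Finset.card_singleton] at h3
  omega

/-- A large finite antipodal set on a sphere with at most `2 * k + 3` normalized inner products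
has only rational ones. -/
theorem IsAntipodal.normalizedInnerProducts_rational {d k : ℕ} {r : ℝ} (hr : 0 < r)
    {Z : Finset (EuclideanSpace ℝ (Fin d))}
    (hZ : IsAntipodal (Z : Set (EuclideanSpace ℝ (Fin d)))) (hZr : ∀ z ∈ Z, ‖z‖ = r)
    (hA : (normalizedInnerProducts (Z : Set (EuclideanSpace ℝ (Fin d))) r).ncard ≤ 2 * k + 3)
    (hcard : 4 * Nat.choose (d + (2 * k + 1) - 1) (2 * k + 1) < Z.card)
    (hcard' : 4 * Nat.choose (d + 2 * k - 1) (2 * k) < Z.card) :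
    ∀ α ∈ normalizedInnerProducts (Z : Set (EuclideanSpace ℝ (Fin d))) r,
      ∃ q : ℚ, α = (q : ℝ) := by
  classical
  have : IsAddTorsionFree (EuclideanSpace ℝ (Fin d)) := .of_isTorsionFree ℝ _
  have hfin : (normalizedInnerProducts (Z : Set (EuclideanSpace ℝ (Fin d))) r).Finite := by
    refine ((Z ×ˢ Z).image fun w => inner ℝ w.1 w.2 / r ^ 2).finite_toSet.subset ?_
    rintro _ ⟨x, hx, y, hy, -, rfl⟩
    exact Finset.mem_coe.mpr (Finset.mem_image.mpr ⟨(x, y), Finset.mem_product.mpr ⟨hx, hy⟩, rfl⟩)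
  have h0 : (0 : EuclideanSpace ℝ (Fin d)) ∉ Z := fun h => by
    have := hZr 0 h
    rw [norm_zero] at this
    exact hr.ne this
  have hr2 : r ^ 2 ≠ 0 := by positivity
  have hone : ∀ x ∈ Z, ∀ y ∈ Z, inner ℝ x y / r ^ 2 = 1 → x = y := fun x hx y hy h => by
    have h' : inner ℝ x y = ‖x‖ * ‖y‖ := by
      rw [hZr x hx, hZr y hy, (div_eq_one_iff_eq hr2).mp h, sq]
    have := inner_eq_norm_mul_iff_real.mp h'
    rw [hZr x hx, hZr y hy] at this
    exact smul_right_injective _ hr.ne' this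
  have hneg : ∀ x ∈ Z, ∀ y ∈ Z, inner ℝ x y / r ^ 2 = -1 → x = -y := fun x hx y hy h =>
    hone x hx (-y) (hZ y hy) (by rw [inner_neg_right, neg_div, h, neg_neg])
  obtain ⟨z, hz⟩ : Z.Nonempty := Finset.card_pos.mp (by omega)
  -- Only antipodal pairs give `-1`, and `1` never occurs, so erasing `-1` leaves a set symmetric
  -- under negation.
  let A := hfin.toFinset.erase (-1)
  have hAmem : ∀ a, a ∈ A ↔ ∃ x ∈ Z, ∃ y ∈ Z, x ≠ y ∧ x ≠ -y ∧ a = inner ℝ x y / r ^ 2 := by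
    intro a
    simp only [A, Finset.mem_erase, Set.Finite.mem_toFinset, normalizedInnerProducts,
      Set.mem_ofPred_eq, Finset.mem_coe]
    constructor
    · rintro ⟨ha, x, hx, y, hy, hxy, rfl⟩
      refine ⟨x, hx, y, hy, hxy, fun h => ha ?_, rfl⟩
      rw [h, inner_neg_left, real_inner_self_eq_norm_sq, hZr y hy, neg_div, div_self hr2]
    · rintro ⟨x, hx, y, hy, hxy, hxy', rfl⟩
      exact ⟨fun h => hxy' (hneg x hx y hy h), x, hx, y, hy, hxy, rfl⟩
  have hAneg : ∀ a ∈ A, -a ∈ A := by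
    intro a ha
    obtain ⟨x, hx, y, hy, hxy, hxy', rfl⟩ := (hAmem a).mp ha
    refine (hAmem _).mpr ⟨x, hx, -y, hZ y hy, hxy', by rwa [neg_neg], ?_⟩
    rw [inner_neg_right, neg_div]
  have hAcard : A.card ≤ 2 * k + 2 := by
    have hmem : (-1 : ℝ) ∈ hfin.toFinset := by
      rw [Set.Finite.mem_toFinset]
      refine ⟨z, hz, -z, hZ z hz, fun h => h0 (self_eq_neg.mp h ▸ hz), ?_⟩
      rw [inner_neg_right, real_inner_self_eq_norm_sq, hZr z hz, neg_div, div_self hr2]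
    rw [Set.ncard_eq_toFinset_card _ hfin] at hA
    rw [Finset.card_erase_of_mem hmem]
    omega
  obtain ⟨X, hXZ, hXcard, hXneg⟩ := hZ.exists_half h0
  have hAabs : ∀ a ∈ A, |a| ∈ A.filter (0 ≤ ·) := fun a ha =>
    Finset.mem_filter.mpr ⟨(abs_choice a).elim (fun h => h.symm ▸ ha) fun h => h.symm ▸ hAneg a ha,
      abs_nonneg a⟩
  have hrat : ∀ b ∈ A.filter (0 ≤ ·), ¬ Irrational b := by
    refine not_irrational_of_abs_inner_mem hr X (fun x hx => hZr x (hXZ hx)) _ (k := k) ?_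
      (fun b hb => (Finset.mem_filter.mp hb).2) (fun h => ?_) (fun x hx y hy hxy => ?_)
      (by omega) (by omega)
    · have := two_mul_card_filter_nonneg_le A hAneg
      omega
    · obtain ⟨x, hx, y, hy, hxy, -, h⟩ := (hAmem 1).mp (Finset.mem_filter.mp h).1
      exact hxy (hone x hx y hy h.symm)
    · exact hAabs _ ((hAmem _).mpr ⟨x, hXZ hx, y, hXZ hy, hxy,
        fun h => hXneg y hy (h ▸ hx), rfl⟩)
  intro α hα
  by_cases h1 : α = -1
  · exact ⟨-1, by simp [h1]⟩
  · have hαA : α ∈ A := Finset.mem_erase.mpr ⟨h1, hfin.mem_toFinset.mpr hα⟩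
    have := hrat _ (hAabs α hαA)
    simp only [Irrational, not_not, Set.mem_range] at this
    obtain ⟨q, hq⟩ := this
    rcases abs_choice α with h | h
    · exact ⟨q, by rw [hq, h]⟩
    · exact ⟨-q, by push_cast; rw [hq, h, neg_neg]⟩

/-! ### Counting and choice of the layer -/

/-- A layer containing its share of the points is large compared with the spaces of forms of degree
`2 * p - 1` and `2 * p - 2`; here `k = p - 1`. -/
theorem mul_choose_lt_sum {d k : ℕ} (hk : 1 ≤ k)
    (hd : 4 * (k + 1) ^ 2 - 2 * (k + 1) + 1 ≤ d) :
    2 * (k + 1) * Nat.choose (d + (2 * k + 1) - 1) (2 * k + 1) <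
      ∑ i ∈ Finset.range (k + 1),
        Nat.choose (d + 2 * (k + 1) - 1 - 2 * i) (2 * (k + 1) - 2 * i) := by
  have hd' : 4 * (k + 1) ^ 2 + 1 ≤ d + 2 * (k + 1) := by omega
  have h0 : 2 * (k + 1) * Nat.choose (d + (2 * k + 1) - 1) (2 * k + 1) ≤
      Nat.choose (d + 2 * (k + 1) - 1) (2 * (k + 1)) := by
    have h := Nat.add_one_mul_choose_eq (d + 2 * k) (2 * k + 1)
    have e1 : d + (2 * k + 1) - 1 = d + 2 * k := by omega
    have e2 : d + 2 * (k + 1) - 1 = d + 2 * k + 1 := by omega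
    have e3 : 2 * (k + 1) = 2 * k + 1 + 1 := by omega
    rw [e1, e2, e3]
    -- After clearing the factor `2p`, the claim is `4p² ≤ d + 2p - 1`, exactly the bound on `d`.
    refine Nat.le_of_mul_le_mul_right ?_ (Nat.succ_pos (2 * k + 1))
    rw [← h]
    calc (2 * k + 1 + 1) * (d + 2 * k).choose (2 * k + 1) * (2 * k + 1 + 1)
        = (4 * (k + 1) ^ 2) * (d + 2 * k).choose (2 * k + 1) := by ring
      _ ≤ (d + 2 * k + 1) * (d + 2 * k).choose (2 * k + 1) :=
        Nat.mul_le_mul_right _ (by omega)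
  -- The term `i = 1` makes the inequality strict.
  have h1 : 0 < Nat.choose (d + 2 * (k + 1) - 1 - 2 * 1) (2 * (k + 1) - 2 * 1) :=
    Nat.choose_pos (by omega)
  have hsub : ({0, 1} : Finset ℕ) ⊆ Finset.range (k + 1) := by
    intro i hi
    simp only [Finset.mem_insert, Finset.mem_singleton] at hi
    rw [Finset.mem_range]
    omega
  refine lt_of_lt_of_le ?_ (Finset.sum_le_sum_of_subset hsub)
  rw [Finset.sum_pair zero_ne_one]
  simp only [mul_zero, Nat.sub_zero]
  omega

theorem proposition3p4 (p d : ℕ) (hp : 2 ≤ p) (hd : 4 * (p : ℤ) ^ 2 - 2 * (p : ℤ) + 1 ≤ (d : ℤ))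
    (r : Fin p → ℝ) (hr : ∀ i, 0 < r i)
    (Y : Set (EuclideanSpace ℝ (Fin d)))
    (hanti : IsAntipodal Y)
    (hsupp : Y ⊆ ⋃ i, Metric.sphere 0 (r i))
    (hcard : Y.ncard =
      2 * ∑ i ∈ Finset.range p, Nat.choose (d + 2 * p - 1 - 2 * i) (2 * p - 2 * i))
    (hA : ∀ i, (normalizedInnerProducts (layer Y (r i)) (r i)).ncard ≤ 2 * p + 1) :
    ∃ l, (layer Y (r l)).Nonempty ∧
      ∀ α ∈ normalizedInnerProducts (layer Y (r l)) (r l), ∃ q : ℚ, α = (q : ℝ) := by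
  classical
  obtain ⟨k, rfl⟩ : ∃ k, p = k + 1 := ⟨p - 1, by omega⟩
  have hdnat : 4 * (k + 1) ^ 2 - 2 * (k + 1) + 1 ≤ d := by
    have : 4 * (k + 1) ^ 2 + 1 ≤ d + 2 * (k + 1) := by
      zify
      push_cast at hd
      linarith
    have := Nat.le_self_pow two_ne_zero (k + 1)
    omega
  have hsum := mul_choose_lt_sum (by omega) hdnat
  -- `ncard` is `0` on infinite sets, so a positive value forces finiteness.
  have hYfin : Y.Finite := Set.finite_of_ncard_pos (by omega)
  have hfin : ∀ i, (layer Y (r i)).Finite := fun i => hYfin.inter_of_left _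
  have hYcard : Y.ncard ≤ ∑ i, (hfin i).toFinset.card := by
    rw [Set.ncard_eq_toFinset_card _ hYfin]
    refine le_trans (Finset.card_le_card fun y hy => ?_) Finset.card_biUnion_le
    have hyY := hYfin.mem_toFinset.mp hy
    obtain ⟨i, hi⟩ := Set.mem_iUnion.mp (hsupp hyY)
    exact Finset.mem_biUnion.mpr ⟨i, Finset.mem_univ i, (hfin i).mem_toFinset.mpr ⟨hyY, hi⟩⟩
  obtain ⟨l, hl⟩ : ∃ l, 4 * Nat.choose (d + (2 * k + 1) - 1) (2 * k + 1) <
      (hfin l).toFinset.card := by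
    by_contra! h
    have := Finset.sum_le_sum fun i (_ : i ∈ Finset.univ) => h i
    rw [Finset.sum_const, Finset.card_univ, Fintype.card_fin, smul_eq_mul] at this
    linarith
  have hl' : 4 * Nat.choose (d + 2 * k - 1) (2 * k) < (hfin l).toFinset.card := by
    refine lt_of_le_of_lt (Nat.mul_le_mul_left 4 ?_) hl
    have e1 : d + (2 * k + 1) - 1 = d + 2 * k - 1 + 1 := by omega
    rw [e1, Nat.choose_succ_succ']
    exact Nat.le_add_right _ _
  have hanti' : IsAntipodal ((hfin l).toFinset : Set (EuclideanSpace ℝ (Fin d))) := by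
    rw [(hfin l).coe_toFinset]
    exact fun y hy => ⟨hanti y hy.1, by simpa using hy.2⟩
  have hrat := hanti'.normalizedInnerProducts_rational (hr l)
    (fun z hz => mem_sphere_zero_iff_norm.mp ((hfin l).mem_toFinset.mp hz).2)
    (by rw [(hfin l).coe_toFinset]; exact (hA l).trans (by omega)) hl hl'
  rw [(hfin l).coe_toFinset] at hrat
  exact ⟨l, (hfin l).toFinset_nonempty.mp (Finset.card_pos.mp (by omega)), hrat⟩
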